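/- Call a Lebesgue measurable set $D\subset\mathbb{R}^d$ with $0<|D|<\infty$ a spectral set if there is an infinite set $\Lambda\subset\mathbb{R}^d$ such that the exponentials $e^{2\pi i x\cdot\lambda}$, $\lambda\in\Lambda$, form an orthogonal basis of $L^2(D)$. Then for every $d\ge 2$, no affine image of the closed unit ball $B_d=\{x\in\mathbb{R}^d: |x|\le 1\}$ is a spectral set: for every affine map $T:\mathbb{R}^d\to\mathbb{R}^d$, the set $T(B_d)$ is not a spectral set. -/

import Mathlib

open MeasureTheory

/-- The exponential `x ↦ e^{2πi x·ξ}` on `ℝ^d`. -/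
noncomputable def expChar {d : ℕ} (ξ : EuclideanSpace ℝ (Fin d)) :
    EuclideanSpace ℝ (Fin d) → ℂ :=
  fun x => Complex.exp (2 * Real.pi * Complex.I * (inner ℝ x ξ : ℝ))

/-- A domain: a Lebesgue measurable set with finite non-zero Lebesgue measure. -/
def IsFiniteDomain {d : ℕ} (D : Set (EuclideanSpace ℝ (Fin d))) : Prop :=
  NullMeasurableSet D volume ∧ volume D ≠ 0 ∧ volume D ≠ ⊤

/-- The exponentials `e^{2πi x·ξ}`, `ξ ∈ Λ`, belong to `L²(D)` and form an orthogonal basis of this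
Hilbert space: they are pairwise orthogonal and their linear span is dense.
(When `D` has non-zero measure the exponentials are automatically non-zero in `L²(D)`.) -/
def IsExpOrthogonalBasis {d : ℕ} (D Λ : Set (EuclideanSpace ℝ (Fin d))) : Prop :=
  ∃ e : Λ → Lp ℂ 2 (volume.restrict D),
    (∀ ξ : Λ, e ξ =ᵐ[volume.restrict D] expChar (ξ : EuclideanSpace ℝ (Fin d))) ∧
    (Pairwise fun ξ η : Λ => inner ℂ (e ξ) (e η) = 0) ∧
    (Submodule.span ℂ (Set.range e)).topologicalClosure = ⊤

/-- `D` is a spectral set: it is a domain, and `L²(D)` has an orthogonal basis of exponentials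
indexed by an infinite set of frequencies. -/
def IsSpectralSet {d : ℕ} (D : Set (EuclideanSpace ℝ (Fin d))) : Prop :=
  IsFiniteDomain D ∧
    ∃ Λ : Set (EuclideanSpace ℝ (Fin d)), Λ.Infinite ∧ IsExpOrthogonalBasis D Λ

/-! Orthogonality forces the Fourier transform of the ellipsoid to vanish at every nonzero
difference of frequencies. After the linear change of variables `2π A*`, where `A` is the linear
part of `T`, distances between distinct frequencies become positive zeros of the radial profile `q`
of the ball's transform, a multiple of `r^{-d/2} J_{d/2}(r)`.

Completeness makes the frequencies relatively dense (`IsExpOrthogonalBasis.relatively_dense`). Hence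
there are far apart, nearly collinear triples, whose mutual distances satisfy `0 ≤ z₁ + z₂ - z₃ < ε`
with all three large (`exists_almost_collinear`).

The zeros of `q` forbid this (`exists_excess_gap`). By a Prüfer angle they satisfy `z - h z ∈ πℤ`,
where `h` increases to a limit `s` never attained. So `z₁ + z₂ - z₃` is close to some `s + mπ`. If
that number is nonzero, the excess is either negative or bounded below; if it is zero, strict
approach from below makes the excess negative, against the triangle inequality. The value of `s` is
never needed. The dimension enters through the sign of a coefficient `c`, positive exactly when `d ≥
2`; for `d = 1` it vanishes, the zeros are the nonzero multiples of `π`, and exact additive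
relations occur. -/

/-! ### Zeros of an oscillating system and their additive relations. -/

/-- `p² + q²` does not vanish for a solution of the system with `q` nonzero near the origin. -/
theorem energy_pos {p q : ℝ → ℝ} {a c : ℝ} (ha : 0 ≤ a) (hc : 0 ≤ c)
    (hp : ∀ r, 0 < r → HasDerivAt p (-(a / r) * p r + (c / r ^ 2 - 1) * q r) r)
    (hq : ∀ r, 0 < r → HasDerivAt q (p r - a / r * q r) r)
    (h0 : ∀ x, 0 < x → ∃ y, 0 < y ∧ y < x ∧ q y ≠ 0) {x : ℝ} (hx : 0 < x) :
    0 < p x ^ 2 + q x ^ 2 := by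
  by_contra hE
  obtain ⟨y, hy, hyx, hqy⟩ := h0 x hx
  -- On `[y, x]` the energy `E = p² + q²` satisfies `E' ≥ -M E`, so `E e^{Mr}` increases from a
  -- positive value.
  set M : ℝ := 2 * (a / y) + c / y ^ 2 with hM
  have hd : ∀ r ∈ Set.Icc y x, HasDerivAt
      (fun r => (p r ^ 2 + q r ^ 2) * Real.exp (M * r))
      ((2 * p r * (-(a / r) * p r + (c / r ^ 2 - 1) * q r) + 2 * q r * (p r - a / r * q r))
        * Real.exp (M * r) + (p r ^ 2 + q r ^ 2) * (Real.exp (M * r) * M)) r := by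
    intro r hr
    have hr0 : 0 < r := hy.trans_le hr.1
    have h1 := ((hp r hr0).pow 2).add ((hq r hr0).pow 2)
    have h2 : HasDerivAt (fun r => Real.exp (M * r)) (Real.exp (M * r) * M) r := by
      simpa using ((hasDerivAt_id r).const_mul M).exp
    refine (h1.mul h2).congr_deriv ?_
    simp
  have hmono : MonotoneOn (fun r => (p r ^ 2 + q r ^ 2) * Real.exp (M * r)) (Set.Icc y x) := by
    apply monotoneOn_of_deriv_nonneg (convex_Icc y x)
    · exact fun r hr => (hd r hr).continuousAt.continuousWithinAt
    · exact fun r hr => (hd r (interior_subset hr)).differentiableAt.differentiableWithinAt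
    · intro r hr
      have hr' := interior_subset hr
      rw [(hd r hr').deriv]
      have hr0 : 0 < r := hy.trans_le hr'.1
      have e1 : a / r ≤ a / y := div_le_div_of_nonneg_left ha hy hr'.1
      have e2 : c / r ^ 2 ≤ c / y ^ 2 :=
        div_le_div_of_nonneg_left hc (by positivity) (by gcongr; exact hr'.1)
      have e3 : 0 ≤ c / r ^ 2 := by positivity
      have key : 0 ≤ 2 * p r * (-(a / r) * p r + (c / r ^ 2 - 1) * q r)
          + 2 * q r * (p r - a / r * q r) + (p r ^ 2 + q r ^ 2) * M := by
        rw [hM]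
        generalize a / r = A at *
        generalize c / r ^ 2 = C at *
        nlinarith [mul_nonneg (sub_nonneg.2 e1) (sq_nonneg (p r)),
          mul_nonneg (sub_nonneg.2 e1) (sq_nonneg (q r)),
          mul_nonneg (sub_nonneg.2 e2) (sq_nonneg (p r)),
          mul_nonneg (sub_nonneg.2 e2) (sq_nonneg (q r)),
          mul_nonneg e3 (sq_nonneg (p r + q r))]
      have := mul_nonneg key (Real.exp_pos (M * r)).le
      linarith
  have h1 := hmono (Set.left_mem_Icc.2 hyx.le) (Set.right_mem_Icc.2 hyx.le) hyx.le
  have h2 : 0 < (p y ^ 2 + q y ^ 2) * Real.exp (M * y) := by positivity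
  have h3 : (p x ^ 2 + q x ^ 2) * Real.exp (M * x) ≤ 0 :=
    mul_nonpos_of_nonpos_of_nonneg (not_lt.1 hE) (Real.exp_pos _).le
  exact absurd (h2.trans_le (h1.trans h3)) (lt_irrefl _)

/-- Prüfer angle: the zeros `z ≥ 1` of `q` satisfy `z - h z ∈ πℤ` for an increasing function `h`
converging strictly from below to a limit. -/
theorem exists_phase {p q : ℝ → ℝ} {a c : ℝ} (ha : 0 ≤ a) (hc : 0 < c)
    (hp : ∀ r, 0 < r → HasDerivAt p (-(a / r) * p r + (c / r ^ 2 - 1) * q r) r)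
    (hq : ∀ r, 0 < r → HasDerivAt q (p r - a / r * q r) r)
    (h0 : ∀ x, 0 < x → ∃ y, 0 < y ∧ y < x ∧ q y ≠ 0) :
    ∃ (h : ℝ → ℝ) (s : ℝ), MonotoneOn h (Set.Ici 1) ∧ (∀ x, 1 ≤ x → h x < s) ∧
      Filter.Tendsto h Filter.atTop (nhds s) ∧
      ∀ x, 1 ≤ x → q x = 0 → ∃ m : ℤ, x - h x = m * Real.pi := by
  have hE : ∀ x, 0 < x → 0 < p x ^ 2 + q x ^ 2 := fun x hx => energy_pos ha hc.le hp hq h0 hx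
  -- The polar angle `θ` of `(p, q)` has `θ' = 1 - k`; the damping `a / r` affects only the radius.
  -- Hence `θ = r - h` with `h' = k`.
  set k : ℝ → ℝ := fun r => c / r ^ 2 * (q r ^ 2 / (p r ^ 2 + q r ^ 2)) with hk
  have hkc : ContinuousOn k (Set.Ioi 0) := by
    have hpc : ContinuousOn p (Set.Ioi 0) := fun r hr => (hp r hr).continuousAt.continuousWithinAt
    have hqc : ContinuousOn q (Set.Ioi 0) := fun r hr => (hq r hr).continuousAt.continuousWithinAt
    refine ContinuousOn.mul (ContinuousOn.div continuousOn_const (by fun_prop) ?_)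
      (ContinuousOn.div (hqc.pow 2) ((hpc.pow 2).add (hqc.pow 2)) ?_)
    · intro r hr; exact pow_ne_zero _ (ne_of_gt hr)
    · intro r hr; exact (hE r hr).ne'
  have hk0 : ∀ r, 0 < r → 0 ≤ k r := fun r hr => by
    have := hE r hr
    simp only [hk]; positivity
  have hk1 : ∀ r, 0 < r → k r ≤ c / r ^ 2 := fun r hr => by
    have h1 := hE r hr
    have h2 : q r ^ 2 / (p r ^ 2 + q r ^ 2) ≤ 1 := by
      rw [div_le_one h1]; nlinarith [sq_nonneg (p r)]
    exact mul_le_of_le_one_right (by positivity) h2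
  obtain ⟨θ₀, hθ₀⟩ : ∃ θ₀ : ℝ, p 1 * Real.sin θ₀ - q 1 * Real.cos θ₀ = 0 := by
    refine ⟨Complex.arg ⟨p 1, q 1⟩, ?_⟩
    have h1 := Complex.norm_mul_cos_arg ⟨p 1, q 1⟩
    have h2 := Complex.norm_mul_sin_arg ⟨p 1, q 1⟩
    simp only at h1 h2
    generalize Complex.arg ⟨p 1, q 1⟩ = t at *
    generalize ‖(⟨p 1, q 1⟩ : ℂ)‖ = N at *
    rw [← h1, ← h2]; ring
  set h : ℝ → ℝ := fun x => 1 - θ₀ + ∫ t in (1 : ℝ)..x, k t with hh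
  have hhd : ∀ x, 0 < x → HasDerivAt h (k x) x := by
    intro x hx
    have hsub : Set.uIcc 1 x ⊆ Set.Ioi 0 := by
      intro t ht
      exact lt_of_lt_of_le (lt_min one_pos hx) ht.1
    have := intervalIntegral.integral_hasDerivAt_right
      ((hkc.mono hsub).intervalIntegrable)
      (hkc.stronglyMeasurableAtFilter isOpen_Ioi x hx) (hkc.continuousAt (Ioi_mem_nhds hx))
    exact this.const_add _
  have hmono : MonotoneOn h (Set.Ici 1) := by
    apply monotoneOn_of_deriv_nonneg (convex_Ici 1)
    · exact fun r hr => (hhd r (one_pos.trans_le hr)).continuousAt.continuousWithinAt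
    · exact fun r hr => (hhd r (one_pos.trans_le
        (interior_subset hr))).differentiableAt.differentiableWithinAt
    · intro r hr
      have : (0 : ℝ) < r := one_pos.trans_le (interior_subset hr)
      rw [(hhd r this).deriv]
      exact hk0 r this
  -- Since `k ≤ c / r²`, this bounds `h` without an improper integral.
  have hanti : AntitoneOn (fun x => h x + c * x⁻¹) (Set.Ici 1) := by
    have hd : ∀ x, 0 < x →
        HasDerivAt (fun x => h x + c * x⁻¹) (k x + c * (-(x ^ 2)⁻¹)) x := fun x hx =>
      (hhd x hx).add ((hasDerivAt_inv hx.ne').const_mul c)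
    apply antitoneOn_of_deriv_nonpos (convex_Ici 1)
    · exact fun r hr => (hd r (one_pos.trans_le hr)).continuousAt.continuousWithinAt
    · exact fun r hr => (hd r (one_pos.trans_le
        (interior_subset hr))).differentiableAt.differentiableWithinAt
    · intro r hr
      have hr0 : (0 : ℝ) < r := one_pos.trans_le (interior_subset hr)
      rw [(hd r hr0).deriv]
      have := hk1 r hr0
      rw [div_eq_mul_inv] at this
      linarith
  have hbdd : ∀ x, 1 ≤ x → h x ≤ h 1 + c := by
    intro x hx
    have h1 := hanti (Set.mem_Ici.2 le_rfl) (Set.mem_Ici.2 hx) hx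
    have h2 : 0 ≤ c * x⁻¹ := by positivity
    simp only [inv_one, mul_one] at h1
    linarith
  have hmono' : Monotone (fun x => h (max x 1)) := fun x y hxy =>
    hmono (Set.mem_Ici.2 (le_max_right _ _)) (Set.mem_Ici.2 (le_max_right _ _))
      (max_le_max_right 1 hxy)
  have hbdd' : BddAbove (Set.range fun x => h (max x 1)) :=
    ⟨h 1 + c, by rintro _ ⟨x, rfl⟩; exact hbdd _ (le_max_right _ _)⟩
  set s : ℝ := ⨆ x, h (max x 1) with hs
  have hle : ∀ x, 1 ≤ x → h x ≤ s := by
    intro x hx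
    have := le_ciSup hbdd' x
    rwa [max_eq_left hx] at this
  refine ⟨h, s, hmono, ?_, ?_, ?_⟩
  · intro x hx
    -- If the limit were attained, `k` and so `q` would vanish beyond `x`, then `p` as well,
    -- contradicting positive energy. Here `c > 0` is essential.
    refine lt_of_le_of_ne (hle x hx) fun heq => ?_
    have hconst : ∀ y, x ≤ y → h y = s := fun y hy =>
      le_antisymm (hle y (hx.trans hy))
        (heq ▸ hmono (Set.mem_Ici.2 hx) (Set.mem_Ici.2 (hx.trans hy)) hy)
    have hq0 : ∀ y, x < y → q y = 0 := by
      intro y hy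
      have hy0 : 0 < y := one_pos.trans_le (hx.trans hy.le)
      have hev : h =ᶠ[nhds y] fun _ => s := by
        filter_upwards [Ioi_mem_nhds hy] with z hz using hconst z (le_of_lt hz)
      have h1 : k y = 0 :=
        ((hhd y hy0).congr_of_eventuallyEq hev.symm).unique (hasDerivAt_const y s)
      have h2 := hE y hy0
      have h3 : c / y ^ 2 ≠ 0 := by positivity
      have h4 := (mul_eq_zero.1 h1).resolve_left h3
      have h5 := (div_eq_zero_iff.1 h4).resolve_right h2.ne'
      exact pow_eq_zero_iff (two_ne_zero) |>.1 h5
    have hy : x < x + 1 := by linarith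
    have hy0 : 0 < x + 1 := by linarith
    have hev : q =ᶠ[nhds (x + 1)] fun _ => 0 := by
      filter_upwards [Ioi_mem_nhds hy] with z hz using hq0 z hz
    have h1 := ((hq _ hy0).congr_of_eventuallyEq hev.symm).unique (hasDerivAt_const _ 0)
    have h2 := hE _ hy0
    rw [hq0 _ hy] at h1 h2
    have h3 : p (x + 1) = 0 := by linarith
    simp [h3] at h2
  · refine (tendsto_atTop_ciSup hmono' hbdd').congr' ?_
    filter_upwards [Filter.eventually_ge_atTop 1] with x hx
    rw [max_eq_left hx]
  · intro x hx hqx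
    -- `b² / (p² + q²)` is the squared sine of the angle between `(p, q)` and the direction `r - h
    -- r`. It is constant and zero at `1`, which avoids a continuous choice of the polar angle.
    set b : ℝ → ℝ := fun r => p r * Real.sin (r - h r) - q r * Real.cos (r - h r) with hb
    have hd : ∀ r, 0 < r → HasDerivAt (fun r => b r ^ 2 / (p r ^ 2 + q r ^ 2)) 0 r := by
      intro r hr
      have hθ : HasDerivAt (fun r => r - h r) (1 - k r) r := (hasDerivAt_id r).sub (hhd r hr)
      have hbd := ((hp r hr).mul hθ.sin).sub ((hq r hr).mul hθ.cos)
      have hEd := ((hp r hr).pow 2).add ((hq r hr).pow 2)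
      have hE0 := (hE r hr).ne'
      refine ((hbd.pow 2).div hEd hE0).congr_deriv ?_
      rw [div_eq_zero_iff]
      left
      simp only [hk, Pi.add_apply, Pi.pow_apply, Pi.sub_apply, Pi.mul_apply]
      generalize Real.sin (r - h r) = S
      generalize Real.cos (r - h r) = C
      generalize c / r ^ 2 = c'
      generalize a / r = a'
      generalize p r = P at *
      generalize q r = Q at *
      field_simp
      ring
    have hconst : b x ^ 2 / (p x ^ 2 + q x ^ 2) = b 1 ^ 2 / (p 1 ^ 2 + q 1 ^ 2) := by
      refine constant_of_has_deriv_right_zero (a := 1) (b := x)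
        (f := fun r => b r ^ 2 / (p r ^ 2 + q r ^ 2)) ?_ ?_ x (Set.right_mem_Icc.2 hx)
      · exact fun r hr => (hd r (one_pos.trans_le hr.1)).continuousAt.continuousWithinAt
      · exact fun r hr => (hd r (one_pos.trans_le hr.1)).hasDerivWithinAt
    have hh1 : 1 - h 1 = θ₀ := by simp [hh]
    have hb1 : b 1 = 0 := by simp only [hb, hh1]; exact hθ₀
    have hEx := hE x (one_pos.trans_le hx)
    rw [hb1, zero_pow two_ne_zero, zero_div, div_eq_zero_iff] at hconst
    have hbx := pow_eq_zero_iff two_ne_zero |>.1 (hconst.resolve_right hEx.ne')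
    simp only [hb, hqx, zero_mul, sub_zero] at hbx
    have hpx : p x ≠ 0 := by
      intro h0
      simp [h0, hqx] at hEx
    obtain ⟨m, hm⟩ := Real.sin_eq_zero_iff.1 ((mul_eq_zero.1 hbx).resolve_left hpx)
    exact ⟨m, hm.symm⟩

/-- Three large zeros of `q` cannot almost satisfy `z₁ + z₂ = z₃` with a nonnegative excess. -/
theorem exists_excess_gap {p q : ℝ → ℝ} {a c : ℝ} (ha : 0 ≤ a) (hc : 0 < c)
    (hp : ∀ r, 0 < r → HasDerivAt p (-(a / r) * p r + (c / r ^ 2 - 1) * q r) r)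
    (hq : ∀ r, 0 < r → HasDerivAt q (p r - a / r * q r) r)
    (h0 : ∀ x, 0 < x → ∃ y, 0 < y ∧ y < x ∧ q y ≠ 0) :
    ∃ R ε : ℝ, 0 < ε ∧ ∀ z₁ z₂ z₃, R ≤ z₁ → R ≤ z₂ → z₁ ≤ z₃ → q z₁ = 0 → q z₂ = 0 →
      q z₃ = 0 → z₃ ≤ z₁ + z₂ → ε ≤ z₁ + z₂ - z₃ := by
  obtain ⟨h, s, hmono, hlt, hlim, hzero⟩ := exists_phase ha hc hp hq h0
  -- The set `s + πℤ` is discrete, so its nonzero elements stay away from `0`.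
  obtain ⟨δ, hδ, hδ1, hgap⟩ : ∃ δ : ℝ, 0 < δ ∧ δ < 1 ∧
      ∀ m : ℤ, s + m * Real.pi = 0 ∨ δ ≤ |s + m * Real.pi| := by
    have hπ := Real.pi_pos
    set n : ℤ := ⌊s / Real.pi⌋ with hn
    have h1 : n * Real.pi ≤ s := (le_div_iff₀ hπ).1 (Int.floor_le _)
    have h2 : s < (n + 1) * Real.pi := (div_lt_iff₀ hπ).1 (Int.lt_floor_add_one _)
    have hpi3 := Real.pi_gt_three
    rcases h1.eq_or_lt with h1 | h1
    · refine ⟨1 / 2, by norm_num, by norm_num, fun m => ?_⟩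
      rcases eq_or_ne (m + n) 0 with hm | hm
      · left
        have : (m : ℝ) + n = 0 := by exact_mod_cast hm
        rw [← h1, ← add_mul, add_comm (n : ℝ), this, zero_mul]
      · right
        have : (1 : ℝ) ≤ |(m : ℝ) + n| := by exact_mod_cast Int.one_le_abs hm
        rw [← h1, ← add_mul, add_comm (n : ℝ), abs_mul, abs_of_pos hπ]
        nlinarith
    · refine ⟨min (1 / 2) (min (s - n * Real.pi) ((n + 1) * Real.pi - s)), ?_, ?_, fun m => ?_⟩
      · exact lt_min (by norm_num) (lt_min (by linarith) (by linarith))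
      · exact (min_le_left _ _).trans_lt (by norm_num)
      · right
        rcases le_or_gt 0 (m + n) with hm | hm
        · have hm' : (0 : ℝ) ≤ (m : ℝ) + n := by exact_mod_cast hm
          refine ((min_le_right _ _).trans (min_le_left _ _)).trans (le_trans ?_ (le_abs_self _))
          nlinarith
        · have hm' : (m : ℝ) + n + 1 ≤ 0 := by exact_mod_cast hm
          refine ((min_le_right _ _).trans (min_le_right _ _)).trans (le_trans ?_ (neg_le_abs _))
          nlinarith
  obtain ⟨R, hR⟩ := Filter.eventually_atTop.1 (hlim.eventually (lt_mem_nhds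
    (show s - δ / 4 < s by linarith)))
  refine ⟨max R 1, δ / 2, by linarith, fun z₁ z₂ z₃ h₁ h₂ h₃ e₁ e₂ e₃ htri => ?_⟩
  by_contra! hlt'
  have o₁ := (le_max_right R 1).trans h₁
  have o₂ := (le_max_right R 1).trans h₂
  have a₁ := hR z₁ ((le_max_left R 1).trans h₁)
  have a₂ := hR z₂ ((le_max_left R 1).trans h₂)
  have a₃ := hR z₃ (((le_max_left R 1).trans h₁).trans h₃)
  have b₁ := hlt z₁ o₁
  have b₂ := hlt z₂ o₂
  have b₃ := hlt z₃ (o₁.trans h₃)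
  have hm := hmono (Set.mem_Ici.2 o₁) (Set.mem_Ici.2 (o₁.trans h₃)) h₃
  obtain ⟨m₁, hm₁⟩ := hzero z₁ o₁ e₁
  obtain ⟨m₂, hm₂⟩ := hzero z₂ o₂ e₂
  obtain ⟨m₃, hm₃⟩ := hzero z₃ (o₁.trans h₃) e₃
  have hg := hgap (m₁ + m₂ - m₃)
  -- The first bracket is negative, the second nonpositive because `z₁ ≤ z₃`, and each exceeds `-δ /
  -- 4`.
  have hsum : z₁ + z₂ - z₃ = s + (m₁ + m₂ - m₃ : ℤ) * Real.pi + (h z₂ - s) + (h z₁ - h z₃) := by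
    push_cast
    linear_combination hm₁ + hm₂ - hm₃
  rcases hg with hg | hg
  · rw [hg] at hsum
    linarith
  · rcases le_abs.1 hg with hg | hg <;> linarith

/-! ### The radial profile and its Bessel-type equation. -/

/-- The profile of the Fourier transform of the unit ball of dimension `n + 1`. -/
noncomputable def ballProfile (n : ℕ) (r : ℝ) : ℝ :=
  ∫ t in (-1 : ℝ)..1, √(1 - t ^ 2) ^ n * Real.cos (r * t)

/-- The derivative of `ballProfile n`. -/
noncomputable def ballProfileDeriv (n : ℕ) (r : ℝ) : ℝ :=
  ∫ t in (-1 : ℝ)..1, √(1 - t ^ 2) ^ n * (-Real.sin (r * t) * t)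

theorem hasDerivAt_ballProfile (n : ℕ) (r : ℝ) :
    HasDerivAt (ballProfile n) (ballProfileDeriv n r) r := by
  refine (intervalIntegral.hasDerivAt_integral_of_dominated_loc_of_deriv_le
    (F := fun r t => √(1 - t ^ 2) ^ n * Real.cos (r * t))
    (F' := fun r t => √(1 - t ^ 2) ^ n * (-Real.sin (r * t) * t))
    (bound := fun t => |√(1 - t ^ 2) ^ n * t|) (s := Set.univ) Filter.univ_mem ?_ ?_ ?_ ?_ ?_ ?_).2
  · exact Filter.Eventually.of_forall fun x =>
      (by fun_prop : Continuous _).aestronglyMeasurable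
  · exact (by fun_prop : Continuous _).intervalIntegrable _ _
  · exact (by fun_prop : Continuous _).aestronglyMeasurable
  · refine Filter.Eventually.of_forall fun t _ x _ => ?_
    rw [Real.norm_eq_abs, abs_mul, abs_mul, abs_mul, abs_neg, mul_left_comm, ← abs_mul]
    exact mul_le_of_le_one_left (abs_nonneg _) (Real.abs_sin_le_one _)
  · exact (by fun_prop : Continuous _).intervalIntegrable _ _
  · refine Filter.Eventually.of_forall fun t _ x _ => ?_
    have := (((hasDerivAt_id x).mul_const t).cos).const_mul (√(1 - t ^ 2) ^ n)
    simpa using this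

/-- Differentiating twice brings out `-t² = (1 - t²) - 1`, and `1 - t²` raises the exponent by two.
-/
theorem hasDerivAt_ballProfileDeriv (n : ℕ) (r : ℝ) :
    HasDerivAt (ballProfileDeriv n) (ballProfile (n + 2) r - ballProfile n r) r := by
  have h := (intervalIntegral.hasDerivAt_integral_of_dominated_loc_of_deriv_le (μ := volume)
    (a := -1) (b := 1) (x₀ := r)
    (F := fun r t => √(1 - t ^ 2) ^ n * (-Real.sin (r * t) * t))
    (F' := fun r t => √(1 - t ^ 2) ^ n * (-(Real.cos (r * t) * t) * t))
    (bound := fun t => |√(1 - t ^ 2) ^ n * t * t|) (s := Set.univ) Filter.univ_mem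
    ?_ ?_ ?_ ?_ ?_ ?_).2
  · refine h.congr_deriv ?_
    rw [ballProfile, ballProfile, ← intervalIntegral.integral_sub
      ((by fun_prop : Continuous _).intervalIntegrable _ _)
      ((by fun_prop : Continuous _).intervalIntegrable _ _)]
    refine intervalIntegral.integral_congr fun t ht => ?_
    rw [Set.uIcc_of_le (by norm_num)] at ht
    have h1 : 0 ≤ 1 - t ^ 2 := by nlinarith [ht.1, ht.2]
    simp only [pow_add, Real.sq_sqrt h1]
    ring
  · exact Filter.Eventually.of_forall fun x =>
      (by fun_prop : Continuous _).aestronglyMeasurable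
  · exact (by fun_prop : Continuous _).intervalIntegrable _ _
  · exact (by fun_prop : Continuous _).aestronglyMeasurable
  · refine Filter.Eventually.of_forall fun t _ x _ => ?_
    have : √(1 - t ^ 2) ^ n * (-(Real.cos (x * t) * t) * t)
        = -Real.cos (x * t) * (√(1 - t ^ 2) ^ n * t * t) := by ring
    rw [Real.norm_eq_abs, this, abs_mul, abs_neg]
    exact mul_le_of_le_one_left (abs_nonneg _) (Real.abs_cos_le_one _)
  · exact (by fun_prop : Continuous _).intervalIntegrable _ _
  · refine Filter.Eventually.of_forall fun t _ x _ => ?_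
    have := ((((hasDerivAt_id x).mul_const t).sin).neg.mul_const t).const_mul (√(1 - t ^ 2) ^ n)
    simpa using this

/-- Integration by parts against `√(1 - t²)^(n + 2)`, which vanishes at `±1`. With the second
derivative it gives `q'' + ((n + 2) / r) q' + q = 0`. -/
theorem ballProfileDeriv_eq (n : ℕ) (r : ℝ) :
    (n + 2) * ballProfileDeriv n r = -r * ballProfile (n + 2) r := by
  have key := intervalIntegral.integral_deriv_mul_eq_sub_of_hasDerivAt (a := -1) (b := 1)
    (u := fun t => √(1 - t ^ 2) ^ (n + 2)) (v := fun t => Real.sin (r * t))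
    (u' := fun t => -((n + 2) * (√(1 - t ^ 2) ^ n * t))) (v' := fun t => Real.cos (r * t) * r)
    (by fun_prop) (by fun_prop) ?_ ?_ ((by fun_prop : Continuous _).intervalIntegrable _ _)
    ((by fun_prop : Continuous _).intervalIntegrable _ _)
  · rw [intervalIntegral.integral_add ((by fun_prop : Continuous _).intervalIntegrable _ _)
      ((by fun_prop : Continuous _).intervalIntegrable _ _)] at key
    have e1 : ∫ t in (-1 : ℝ)..1, -((n + 2) * (√(1 - t ^ 2) ^ n * t)) * Real.sin (r * t)
        = (n + 2) * ballProfileDeriv n r := by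
      rw [ballProfileDeriv, ← intervalIntegral.integral_const_mul]
      congr 1; ext t; ring
    have e2 : ∫ t in (-1 : ℝ)..1, √(1 - t ^ 2) ^ (n + 2) * (Real.cos (r * t) * r)
        = r * ballProfile (n + 2) r := by
      rw [ballProfile, ← intervalIntegral.integral_const_mul]
      congr 1; ext t; ring
    rw [e1, e2] at key
    norm_num at key
    linarith
  · intro t ht
    norm_num at ht
    have h1 : 0 < 1 - t ^ 2 := by nlinarith [ht.1, ht.2]
    have h2 := ((((hasDerivAt_id t).pow 2).const_sub 1).sqrt (by simpa using h1.ne')).pow (n + 2)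
    refine h2.congr_deriv ?_
    have h3 : √(1 - t ^ 2) ≠ 0 := (Real.sqrt_pos.2 h1).ne'
    simp
    field_simp
    ring
  · intro t _
    simpa using ((hasDerivAt_id t).const_mul r).sin

theorem ballProfile_zero_pos (n : ℕ) : 0 < ballProfile n 0 := by
  refine intervalIntegral.intervalIntegral_pos_of_pos_on
    ((by fun_prop : Continuous _).intervalIntegrable _ _) ?_ (by norm_num)
  intro t ht
  have h1 : 0 < 1 - t ^ 2 := by nlinarith [ht.1, ht.2]
  simpa using pow_pos (Real.sqrt_pos.2 h1) n

/-- With `a = (n + 2) / 2`, the function `u = r^a q` satisfies `u'' = (c / r² - 1) u` for `c = a (a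
- 1) = n (n + 2) / 4`, and `p = r^{-a} u'`. Positivity of `c` is where `n ≥ 1` is used. -/
theorem exists_ballProfile_excess_gap (n : ℕ) (hn : 1 ≤ n) :
    ∃ R ε : ℝ, 0 < ε ∧ ∀ z₁ z₂ z₃, R ≤ z₁ → R ≤ z₂ → z₁ ≤ z₃ → ballProfile n z₁ = 0 →
      ballProfile n z₂ = 0 → ballProfile n z₃ = 0 → z₃ ≤ z₁ + z₂ → ε ≤ z₁ + z₂ - z₃ := by
  have hn' : (1 : ℝ) ≤ n := by exact_mod_cast hn
  set a : ℝ := (n + 2) / 2 with ha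
  refine exists_excess_gap (p := fun r => ballProfileDeriv n r + a / r * ballProfile n r)
    (a := a) (c := a * (a - 1)) (by positivity) (mul_pos (by positivity) (by linarith)) ?_ ?_ ?_
  · intro r hr
    have h1 := (hasDerivAt_ballProfileDeriv n r).add
      (((hasDerivAt_inv hr.ne').const_mul a).mul (hasDerivAt_ballProfile n r))
    have h2 : ballProfile (n + 2) r = -(2 * a / r) * ballProfileDeriv n r := by
      have := ballProfileDeriv_eq n r
      field_simp
      linear_combination this
    refine h1.congr_deriv ?_
    rw [h2]
    field_simp
    ring
  · intro r _
    refine (hasDerivAt_ballProfile n r).congr_deriv ?_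
    ring
  · intro x hx
    have hc := (hasDerivAt_ballProfile n 0).continuousAt
    obtain ⟨δ, hδ, hb⟩ := Metric.eventually_nhds_iff.1
      (hc.eventually (lt_mem_nhds (ballProfile_zero_pos n)))
    refine ⟨min x δ / 2, by positivity, ?_, (hb ?_).ne'⟩
    · linarith [min_le_left x δ, lt_min hx hδ]
    · rw [Real.dist_0_eq_abs, abs_of_pos (by positivity)]
      linarith [min_le_right x δ, lt_min hx hδ]

/-! ### The Fourier transform of the ball by slicing. -/

/-- Splitting off the first coordinate of a Euclidean space preserves volume. -/
noncomputable def euclideanConsEquiv (n : ℕ) :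
    EuclideanSpace ℝ (Fin (n + 1)) ≃ᵐ ℝ × EuclideanSpace ℝ (Fin n) :=
  ((MeasurableEquiv.toLp 2 (Fin (n + 1) → ℝ)).symm.trans
    (MeasurableEquiv.piFinSuccAbove (fun _ => ℝ) 0)).trans
    (MeasurableEquiv.prodCongr (MeasurableEquiv.refl ℝ) (MeasurableEquiv.toLp 2 (Fin n → ℝ)))

theorem measurePreserving_euclideanConsEquiv (n : ℕ) :
    MeasurePreserving (euclideanConsEquiv n) volume volume := by
  have h1 := EuclideanSpace.volume_preserving_symm_measurableEquiv_toLp (Fin (n + 1))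
  have h2 := volume_preserving_piFinSuccAbove (fun _ : Fin (n + 1) => ℝ) 0
  have h3 := (MeasurePreserving.id (volume : Measure ℝ)).prod
    (PiLp.volume_preserving_toLp (Fin n))
  exact h3.comp (h2.comp h1)

theorem norm_sq_euclideanConsEquiv {n : ℕ} (x : EuclideanSpace ℝ (Fin (n + 1))) :
    (euclideanConsEquiv n x).1 ^ 2 + ‖(euclideanConsEquiv n x).2‖ ^ 2 = ‖x‖ ^ 2 := by
  rw [EuclideanSpace.real_norm_sq_eq, EuclideanSpace.real_norm_sq_eq, Fin.sum_univ_succ]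
  rfl

/-- Fubini: the slice at height `t` is an `n`-ball of radius `√(1 - t²)`. -/
theorem setIntegral_closedBall_coord (n : ℕ) {F : ℝ → ℝ} (hF : Continuous F) :
    ∫ x in Metric.closedBall (0 : EuclideanSpace ℝ (Fin (n + 1))) 1, F (x 0)
      = volume.real (Metric.closedBall (0 : EuclideanSpace ℝ (Fin n)) 1)
        * ∫ t in (-1 : ℝ)..1, √(1 - t ^ 2) ^ n * F t := by
  set S : Set (ℝ × EuclideanSpace ℝ (Fin n)) := {z | z.1 ^ 2 + ‖z.2‖ ^ 2 ≤ 1} with hS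
  have hSc : IsClosed S := isClosed_le (by fun_prop) continuous_const
  have hpre : Metric.closedBall (0 : EuclideanSpace ℝ (Fin (n + 1))) 1
      = euclideanConsEquiv n ⁻¹' S := by
    ext x
    rw [mem_closedBall_zero_iff, Set.mem_preimage, hS, Set.mem_ofPred_eq,
      norm_sq_euclideanConsEquiv, sq_le_one_iff₀ (norm_nonneg x)]
  have hScpt : IsCompact S := by
    refine ((isCompact_Icc (a := (-1 : ℝ)) (b := 1)).prod
      (isCompact_closedBall (0 : EuclideanSpace ℝ (Fin n)) 1)).of_isClosed_subset hSc ?_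
    rintro ⟨t, y⟩ h
    have h' : t ^ 2 + ‖y‖ ^ 2 ≤ 1 := h
    refine ⟨⟨?_, ?_⟩, ?_⟩
    · nlinarith [sq_nonneg ‖y‖]
    · nlinarith [sq_nonneg ‖y‖]
    · rw [mem_closedBall_zero_iff]
      nlinarith [sq_nonneg t, norm_nonneg y]
  have hint : Integrable (S.indicator fun z => F z.1) (volume.prod volume) :=
    (integrable_indicator_iff hSc.measurableSet).2
      ((hF.comp continuous_fst).continuousOn.integrableOn_compact hScpt)
  have hslice : ∀ t, ∫ y, S.indicator (fun z => F z.1) (t, y)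
      = (Set.Icc (-1) 1).indicator (fun t =>
        volume.real (Metric.closedBall (0 : EuclideanSpace ℝ (Fin n)) 1)
          * (√(1 - t ^ 2) ^ n * F t)) t := by
    intro t
    by_cases ht : t ∈ Set.Icc (-1 : ℝ) 1
    · have h1 : 0 ≤ 1 - t ^ 2 := by nlinarith [ht.1, ht.2]
      rw [Set.indicator_of_mem ht]
      have h2 : (fun y => S.indicator (fun z => F z.1) (t, y))
          = (Metric.closedBall (0 : EuclideanSpace ℝ (Fin n)) (√(1 - t ^ 2))).indicator
            fun _ => F t := by
        ext y
        have : (t, y) ∈ S ↔ y ∈ Metric.closedBall (0 : EuclideanSpace ℝ (Fin n)) (√(1 - t ^ 2)) := by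
          rw [mem_closedBall_zero_iff, Real.le_sqrt (norm_nonneg y) h1, hS, Set.mem_ofPred_eq]
          constructor <;> intro h <;> linarith
        by_cases hy : (t, y) ∈ S
        · rw [Set.indicator_of_mem hy, Set.indicator_of_mem (this.1 hy)]
        · rw [Set.indicator_of_notMem hy, Set.indicator_of_notMem (mt this.2 hy)]
      rw [h2, integral_indicator_const _ Metric.isClosed_closedBall.measurableSet,
        Measure.addHaar_real_closedBall' _ _ (Real.sqrt_nonneg _), finrank_euclideanSpace_fin,
        smul_eq_mul]
      ring
    · rw [Set.indicator_of_notMem ht]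
      refine integral_eq_zero_of_ae (Filter.Eventually.of_forall fun y => ?_)
      refine Set.indicator_of_notMem (fun h => ht ?_) _
      have h' : t ^ 2 + ‖y‖ ^ 2 ≤ 1 := h
      constructor <;> nlinarith [sq_nonneg ‖y‖]
  calc ∫ x in Metric.closedBall (0 : EuclideanSpace ℝ (Fin (n + 1))) 1, F (x 0)
      = ∫ z in S, F z.1 := by
        rw [hpre]
        exact (measurePreserving_euclideanConsEquiv n).setIntegral_preimage_emb
          (euclideanConsEquiv n).measurableEmbedding (fun z => F z.1) S
    _ = ∫ z, S.indicator (fun z => F z.1) z := (integral_indicator hSc.measurableSet).symm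
    _ = ∫ t, ∫ y, S.indicator (fun z => F z.1) (t, y) := integral_prod _ hint
    _ = _ := by
        simp_rw [hslice]
        rw [integral_indicator measurableSet_Icc, integral_const_mul,
          intervalIntegral.integral_of_le (by norm_num), integral_Icc_eq_integral_Ioc]

theorem exists_linearIsometryEquiv_apply_eq {E : Type*} [NormedAddCommGroup E]
    [InnerProductSpace ℝ E] [FiniteDimensional ℝ E] {v w : E} (h : ‖v‖ = ‖w‖) :
    ∃ e : E ≃ₗᵢ[ℝ] E, e v = w :=
  ⟨_, Submodule.reflection_sub h⟩

/-- A linear isometry carries `y` to the first axis and preserves the ball. -/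
theorem setIntegral_closedBall_cos_inner (n : ℕ) (y : EuclideanSpace ℝ (Fin (n + 1))) :
    ∫ x in Metric.closedBall (0 : EuclideanSpace ℝ (Fin (n + 1))) 1, Real.cos (inner ℝ x y)
      = volume.real (Metric.closedBall (0 : EuclideanSpace ℝ (Fin n)) 1) * ballProfile n ‖y‖ := by
  obtain ⟨e, he⟩ := exists_linearIsometryEquiv_apply_eq
    (v := EuclideanSpace.single (0 : Fin (n + 1)) ‖y‖) (w := y) (by simp)
  have hpre : e ⁻¹' Metric.closedBall 0 1 = Metric.closedBall 0 1 := by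
    ext x; simp
  rw [← e.measurePreserving.setIntegral_preimage_emb
    e.toHomeomorph.measurableEmbedding (fun x => Real.cos (inner ℝ x y)) (Metric.closedBall 0 1),
    hpre]
  have h1 : ∀ x, inner ℝ (e x) y = ‖y‖ * x 0 := by
    intro x
    conv_lhs => rw [← he, e.inner_map_map, real_inner_comm]
    simp [EuclideanSpace.inner_single_left]
  simp_rw [h1]
  exact setIntegral_closedBall_coord n (F := fun t => Real.cos (‖y‖ * t)) (by fun_prop)

/-! ### Parseval and relative density of the frequencies. -/

theorem HilbertBasis.hasSum_norm_inner_sq {ι H : Type*} [NormedAddCommGroup H]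
    [InnerProductSpace ℂ H] (b : HilbertBasis ι ℂ H) (x : H) :
    HasSum (fun i => ‖inner ℂ (b i) x‖ ^ 2) (‖x‖ ^ 2) := by
  have h := b.hasSum_inner_mul_inner x x
  rw [inner_self_eq_norm_sq_to_K] at h
  have h2 : ∀ i, inner ℂ x (b i) * inner ℂ (b i) x = ((‖inner ℂ (b i) x‖ ^ 2 : ℝ) : ℂ) := by
    intro i
    rw [← inner_conj_symm, RCLike.conj_mul]
    simp
  simp_rw [h2] at h
  rw [← Complex.hasSum_ofReal]
  simpa using h

theorem continuous_expChar {d : ℕ} (ξ : EuclideanSpace ℝ (Fin d)) : Continuous (expChar ξ) := by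
  unfold expChar
  fun_prop

theorem norm_expChar {d : ℕ} (ξ x : EuclideanSpace ℝ (Fin d)) : ‖expChar ξ x‖ = 1 := by
  have : (2 * Real.pi * Complex.I * (inner ℝ x ξ : ℝ) : ℂ)
      = ((2 * Real.pi * inner ℝ x ξ : ℝ) : ℂ) * Complex.I := by push_cast; ring
  rw [expChar, this, Complex.norm_exp_ofReal_mul_I]

theorem conj_expChar_mul {d : ℕ} (ξ η x : EuclideanSpace ℝ (Fin d)) :
    (starRingEnd ℂ) (expChar ξ x) * expChar η x = expChar (η - ξ) x := by
  simp only [expChar, ← Complex.exp_conj, ← Complex.exp_add]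
  congr 1
  simp only [map_mul, Complex.conj_ofReal, Complex.conj_I, inner_sub_right, Complex.ofReal_sub,
    map_ofNat]
  ring

theorem memLp_mul_expChar {d : ℕ} (D : Set (EuclideanSpace ℝ (Fin d)))
    {φ : EuclideanSpace ℝ (Fin d) → ℂ} (hφ : Continuous φ) (hc : HasCompactSupport φ)
    (ξ : EuclideanSpace ℝ (Fin d)) :
    MemLp (fun x => φ x * expChar ξ x) 2 (volume.restrict D) :=
  ((hφ.mul (continuous_expChar ξ)).memLp_of_hasCompactSupport hc.mul_right).restrict D

/-- The modulation `φ e^{2πi x·ξ}` as an element of `L²(D)`. -/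
theorem exists_modulation {d : ℕ} {D : Set (EuclideanSpace ℝ (Fin d))}
    {φ : EuclideanSpace ℝ (Fin d) → ℂ} (hφ : Continuous φ) (hc : HasCompactSupport φ)
    (hD : ∀ x, x ∉ D → φ x = 0) (ξ : EuclideanSpace ℝ (Fin d)) :
    ∃ F : Lp ℂ 2 (volume.restrict D), ‖F‖ = (eLpNorm φ 2 (volume.restrict D)).toReal ∧
      ∀ (lam : EuclideanSpace ℝ (Fin d)) (e : Lp ℂ 2 (volume.restrict D)),
        e =ᵐ[volume.restrict D] expChar lam →
        inner ℂ e F = FourierTransform.fourier φ (lam - ξ) := by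
  have hm := memLp_mul_expChar D hφ hc ξ
  refine ⟨hm.toLp _, ?_, fun lam e he => ?_⟩
  · rw [Lp.norm_toLp]
    congr 1
    refine eLpNorm_congr_norm_ae (Filter.Eventually.of_forall fun x => ?_)
    rw [norm_mul, norm_expChar, mul_one]
  rw [L2.inner_def, Real.fourier_eq']
  have h1 : ∫ x in D, inner ℂ (e x) (hm.toLp _ x) = ∫ x in D, φ x * expChar (ξ - lam) x := by
    refine integral_congr_ae ?_
    filter_upwards [he, hm.coeFn_toLp] with x h1 h2
    rw [h1, h2, ← conj_expChar_mul, RCLike.inner_apply]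
    ring
  rw [h1, setIntegral_eq_integral_of_forall_compl_eq_zero fun x hx => by rw [hD x hx, zero_mul]]
  congr 1
  ext x
  rw [smul_eq_mul, mul_comm, expChar]
  congr 2
  rw [← neg_sub lam ξ, inner_neg_right]
  push_cast
  ring

theorem fourier_fderiv_apply {E : Type*} [NormedAddCommGroup E] [InnerProductSpace ℝ E]
    [FiniteDimensional ℝ E] [MeasurableSpace E] [BorelSpace E] {φ : E → ℂ}
    (hφ : ContDiff ℝ 1 φ) (hc : HasCompactSupport φ) (v η : E) :
    FourierTransform.fourier (fun x => fderiv ℝ φ x v) η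
      = 2 * Real.pi * Complex.I * (inner ℝ η v : ℝ) * FourierTransform.fourier φ η := by
  have hd : Integrable (fderiv ℝ φ) :=
    (hφ.continuous_fderiv one_ne_zero).integrable_of_hasCompactSupport (hc.fderiv ℝ)
  have h := Real.fourier_fderiv (hφ.continuous.integrable_of_hasCompactSupport hc)
    (hφ.differentiable one_ne_zero) hd
  have h2 := congrArg (fun L => L v) (congrFun h η)
  rw [Real.fourier_continuousLinearMap_apply hd] at h2
  rw [h2]
  rw [VectorFourier.fourierSMulRight_apply]
  simp only [neg_apply, neg_smul, smul_eq_mul, Complex.real_smul]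
  change -_ * -(((inner ℝ η v : ℝ) : ℂ) * _) = _
  ring

/-- The normalization of an orthogonal basis. -/
theorem exists_hilbertBasis_of_orthogonal {ι H : Type*} [NormedAddCommGroup H]
    [InnerProductSpace ℂ H] [CompleteSpace H] {e : ι → H} (h0 : ∀ i, e i ≠ 0)
    (ho : Pairwise fun i j => inner ℂ (e i) (e j) = 0)
    (hs : (Submodule.span ℂ (Set.range e)).topologicalClosure = ⊤) :
    ∃ b : HilbertBasis ι ℂ H, ∀ i, b i = ((‖e i‖⁻¹ : ℝ) : ℂ) • e i := by
  have hv : Orthonormal ℂ fun i => ((‖e i‖⁻¹ : ℝ) : ℂ) • e i := by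
    refine ⟨fun i => ?_, fun i j hij => ?_⟩
    · rw [norm_smul, Complex.norm_real, norm_inv, norm_norm,
        inv_mul_cancel₀ (norm_ne_zero_iff.2 (h0 i))]
    · change inner ℂ (((‖e i‖⁻¹ : ℝ) : ℂ) • e i) (((‖e j‖⁻¹ : ℝ) : ℂ) • e j) = 0
      rw [inner_smul_left, inner_smul_right, ho hij, mul_zero, mul_zero]
  refine ⟨HilbertBasis.mk hv ?_, fun i => by rw [HilbertBasis.coe_mk]⟩
  rw [← hs]
  refine Submodule.topologicalClosure_mono (Submodule.span_le.2 ?_)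
  rintro _ ⟨i, rfl⟩
  have h1 : ((‖e i‖ : ℝ) : ℂ) ≠ 0 := by exact_mod_cast norm_ne_zero_iff.2 (h0 i)
  have h2 : e i = ((‖e i‖ : ℝ) : ℂ) • (((‖e i‖⁻¹ : ℝ) : ℂ) • e i) := by
    rw [smul_smul, Complex.ofReal_inv, mul_inv_cancel₀ h1, one_smul]
  rw [SetLike.mem_coe, h2]
  exact Submodule.smul_mem _ _ (Submodule.subset_span ⟨i, rfl⟩)

/-- The frequencies of an orthogonal basis of exponentials are relatively dense. -/
theorem IsExpOrthogonalBasis.relatively_dense {d : ℕ} {D Λ : Set (EuclideanSpace ℝ (Fin d))}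
    (hD : (interior D).Nonempty) (h : IsExpOrthogonalBasis D Λ) :
    ∃ R : ℝ, ∀ ξ, ∃ lam ∈ Λ, ‖lam - ξ‖ ≤ R := by
  obtain ⟨e, he, ho, hs⟩ := h
  obtain ⟨x₀, hx₀⟩ := hD
  obtain ⟨ε, hε, hball⟩ := Metric.isOpen_iff.1 isOpen_interior x₀ hx₀
  have hballD : Metric.ball x₀ ε ⊆ D := hball.trans interior_subset
  have hne : ∀ {r : ℝ}, 0 < r → r ≤ ε → ∀ {g : EuclideanSpace ℝ (Fin d) → ℂ},
      (∀ x ∈ Metric.ball x₀ r, g x ≠ 0) → ¬ g =ᵐ[volume.restrict D] 0 := by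
    intro r hr hrε g hg hg0
    have h1 : g =ᵐ[volume.restrict (Metric.ball x₀ r)] 0 :=
      ae_mono (Measure.restrict_mono ((Metric.ball_subset_ball hrε).trans hballD) le_rfl) hg0
    rw [Filter.EventuallyEq, ae_restrict_iff' measurableSet_ball] at h1
    have h2 : volume (Metric.ball x₀ r) = 0 :=
      measure_mono_null (t := {x | ¬ (x ∈ Metric.ball x₀ r → g x = 0)})
        (fun x hx hx' => hg x hx (hx' hx)) h1
    exact (Metric.measure_ball_pos volume x₀ hr).ne' h2
  have he0 : ∀ i, e i ≠ 0 := by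
    intro i hi
    refine hne hε le_rfl (g := expChar i) (fun x _ => ?_) ?_
    · rw [← norm_ne_zero_iff, norm_expChar]; exact one_ne_zero
    · exact (he i).symm.trans (hi ▸ Lp.coeFn_zero _ _ _)
  obtain ⟨b, hb⟩ := exists_hilbertBasis_of_orthogonal he0 ho hs
  let B : ContDiffBump x₀ := ⟨ε / 4, ε / 2, by linarith, by linarith⟩
  set φ : EuclideanSpace ℝ (Fin d) → ℂ := fun x => (B x : ℂ) with hφdef
  have hφ : ContDiff ℝ 1 φ := Complex.ofRealCLM.contDiff.comp B.contDiff
  have hc : HasCompactSupport φ := B.hasCompactSupport.comp_left Complex.ofReal_zero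
  have hφD : ∀ x, ε / 2 < dist x x₀ → φ x = 0 := fun x hx =>
    Complex.ofReal_eq_zero.2 (B.zero_of_le_dist hx.le)
  have hdist : ∀ x, x ∉ D → ε / 2 < dist x x₀ := fun x hx => by
    have : ε ≤ dist x x₀ := not_lt.1 fun h => hx (hballD h)
    linarith
  set v : Fin d → EuclideanSpace ℝ (Fin d) := fun j => EuclideanSpace.single j 1
  set g : Fin d → EuclideanSpace ℝ (Fin d) → ℂ := fun j x => fderiv ℝ φ x (v j)
  have hg : ∀ j, Continuous (g j) := fun j =>
    (hφ.continuous_fderiv one_ne_zero).clm_apply continuous_const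
  have hgc : ∀ j, HasCompactSupport (g j) := fun j => hc.fderiv_apply ℝ (v j)
  have hgD : ∀ j x, x ∉ D → g j x = 0 := by
    intro j x hx
    have hev : φ =ᶠ[nhds x] fun _ => 0 := by
      filter_upwards [(isOpen_lt continuous_const (continuous_id.dist continuous_const)).mem_nhds
        (hdist x hx)] with y hy using hφD y hy
    simp only [g]
    rw [hev.fderiv_eq]
    simp
  obtain ⟨N, hNe⟩ : ∃ N, N = (eLpNorm φ 2 (volume.restrict D)).toReal := ⟨_, rfl⟩
  obtain ⟨G, hGe⟩ : ∃ G, G = ∑ j, (eLpNorm (g j) 2 (volume.restrict D)).toReal ^ 2 := ⟨_, rfl⟩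
  have hG : 0 ≤ G := hGe ▸ Finset.sum_nonneg fun _ _ => sq_nonneg _
  have hN : 0 < N := by
    rw [hNe]
    refine ENNReal.toReal_pos (fun h0 => ?_)
      ((hφ.continuous.memLp_of_hasCompactSupport hc).restrict D).eLpNorm_ne_top
    rw [eLpNorm_eq_zero_iff hφ.continuous.aestronglyMeasurable two_ne_zero] at h0
    refine hne (by linarith : 0 < ε / 4) (by linarith) (g := φ) (fun x hx => ?_) h0
    rw [hφdef]
    simp only
    rw [Complex.ofReal_ne_zero, B.one_of_mem_closedBall (Metric.ball_subset_closedBall hx)]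
    exact one_ne_zero
  -- Parseval for the modulated bump `φ` and its partial derivatives: if every frequency were
  -- farther than `R` from `ξ`, then `R² N² ≤ G`. This fails as `R ≥ 1` and `R N² = G + N²`. Both
  -- `N` and `G` are independent of `ξ`.
  refine ⟨G / N ^ 2 + 1, fun ξ => ?_⟩
  by_contra! hcon
  set R := G / N ^ 2 + 1 with hR
  have hR0 : 0 ≤ G / N ^ 2 := div_nonneg hG (sq_nonneg N)
  obtain ⟨F, hF, hFi⟩ := exists_modulation hφ.continuous hc (fun x hx => hφD x (hdist x hx)) ξ
  choose K hK hKi using fun j => exists_modulation (hg j) (hgc j) (hgD j) ξ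
  have hsf := (b.hasSum_norm_inner_sq F).mul_left (R ^ 2)
  have hsg := hasSum_sum (s := Finset.univ) fun j _ => b.hasSum_norm_inner_sq (K j)
  have hle := hasSum_le (fun i => ?_) hsf hsg
  · simp_rw [hF, hK, ← hNe, ← hGe] at hle
    have h1 : R * N ^ 2 = G + N ^ 2 := by rw [hR]; field_simp
    have h2 : R * N ^ 2 ≤ R ^ 2 * N ^ 2 := by
      gcongr
      nlinarith
    have h3 : 0 < N ^ 2 := by positivity
    exact absurd (h2.trans hle) (by rw [h1]; exact not_le.2 (by linarith))
  · simp_rw [hb, inner_smul_left, norm_mul, mul_pow, hFi i (e i) (he i),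
      fun j => hKi j i (e i) (he i), g, fourier_fderiv_apply hφ hc]
    set c := ‖(starRingEnd ℂ) ((‖e i‖⁻¹ : ℝ) : ℂ)‖ ^ 2
    set w := (i : EuclideanSpace ℝ (Fin d)) - ξ with hw
    set M := ‖FourierTransform.fourier φ w‖ ^ 2
    have hn : ‖w‖ ^ 2 = ∑ j, (inner ℝ w (v j)) ^ 2 := by
      rw [EuclideanSpace.real_norm_sq_eq]
      simp [v, EuclideanSpace.inner_single_right]
    have hterm : ∀ j, c * ((inner ℝ w (v j)) ^ 2 * M)
        ≤ c * ‖2 * Real.pi * Complex.I * (inner ℝ w (v j) : ℝ) * FourierTransform.fourier φ w‖ ^ 2 := by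
      intro j
      rw [norm_mul, norm_mul, mul_pow, mul_pow, Complex.norm_real, Real.norm_eq_abs, sq_abs]
      have h2 : (1 : ℝ) ≤ ‖(2 * Real.pi * Complex.I : ℂ)‖ := by
        rw [norm_mul, norm_mul, Complex.norm_I, Complex.norm_real, Real.norm_eq_abs,
          abs_of_pos Real.pi_pos, Complex.norm_ofNat]
        linarith [Real.pi_gt_three]
      have h3 : (1 : ℝ) ≤ ‖(2 * Real.pi * Complex.I : ℂ)‖ ^ 2 := one_le_pow₀ h2
      gcongr
      exact le_mul_of_one_le_left (sq_nonneg _) h3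
    refine le_trans ?_ (Finset.sum_le_sum fun j _ => hterm j)
    rw [← Finset.mul_sum, ← Finset.sum_mul, ← hn, mul_left_comm]
    gcongr
    exact (hcon i i.2).le

/-! ### Almost collinear triples. -/

/-- A relatively dense set contains almost collinear triples of far apart points. -/
theorem exists_almost_collinear {E : Type*} [NormedAddCommGroup E] [InnerProductSpace ℝ E]
    {M : Set E} {r : ℝ} (hM : ∀ ζ, ∃ m ∈ M, ‖m - ζ‖ ≤ r) {u : E} (hu : ‖u‖ = 1) (R : ℝ) {ε : ℝ}
    (hε : 0 < ε) :
    ∃ m₁ ∈ M, ∃ m₂ ∈ M, ∃ m₃ ∈ M, 0 < ‖m₂ - m₁‖ ∧ 0 < ‖m₃ - m₂‖ ∧ R ≤ ‖m₂ - m₁‖ ∧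
      R ≤ ‖m₃ - m₂‖ ∧ ‖m₂ - m₁‖ ≤ ‖m₃ - m₁‖ ∧ ‖m₂ - m₁‖ + ‖m₃ - m₂‖ - ‖m₃ - m₁‖ < ε := by
  have hr : 0 ≤ r := by
    obtain ⟨m, -, hm⟩ := hM 0
    exact (norm_nonneg _).trans hm
  have hq : 0 ≤ 16 * r ^ 2 / ε := by positivity
  -- The points are chosen near `0`, `t u`, `2 t u`; `6 r` ensures `‖a‖ ≤ ‖a + b‖`, and `16 r² / ε`
  -- makes the excess small.
  set t := 6 * r + |R| + 16 * r ^ 2 / ε + 1 with ht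
  clear_value t
  have hR := le_abs_self R
  have hR' := abs_nonneg R
  obtain ⟨m₁, h₁, e₁⟩ := hM 0
  obtain ⟨m₂, h₂, e₂⟩ := hM (t • u)
  obtain ⟨m₃, h₃, e₃⟩ := hM ((2 * t) • u)
  have ht0 : 0 ≤ t := by linarith
  have htu : ‖t • u‖ = t := by
    rw [norm_smul, hu, mul_one, Real.norm_eq_abs, abs_of_nonneg ht0]
  set a := m₂ - m₁ with ha
  set b := m₃ - m₂ with hb
  have hab : m₃ - m₁ = a + b := by rw [ha, hb]; abel
  have ea : ‖a - t • u‖ ≤ 2 * r := by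
    have : a - t • u = (m₂ - t • u) - (m₁ - 0) := by rw [ha]; abel
    rw [this]
    linarith [norm_sub_le (m₂ - t • u) (m₁ - 0)]
  have eb : ‖b - t • u‖ ≤ 2 * r := by
    have : b - t • u = (m₃ - (2 * t) • u) - (m₂ - t • u) := by rw [hb]; module
    rw [this]
    linarith [norm_sub_le (m₃ - (2 * t) • u) (m₂ - t • u)]
  have la : t - 2 * r ≤ ‖a‖ := by
    linarith [norm_sub_norm_le (t • u) a, norm_sub_rev a (t • u)]
  have lb : t - 2 * r ≤ ‖b‖ := by
    linarith [norm_sub_norm_le (t • u) b, norm_sub_rev b (t • u)]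
  have ua : ‖a‖ ≤ t + 2 * r := by linarith [norm_sub_norm_le a (t • u)]
  have lab : 2 * t - 4 * r ≤ ‖a + b‖ := by
    have h1 : ‖(2 : ℝ) • (t • u)‖ = 2 * t := by rw [norm_smul, htu]; norm_num
    have h2 : (2 : ℝ) • (t • u) - (a + b) = -(a - t • u) - (b - t • u) := by
      rw [two_smul]; abel
    have h3 := norm_sub_norm_le ((2 : ℝ) • (t • u)) (a + b)
    rw [h1, h2] at h3
    have h4 := norm_sub_le (-(a - t • u)) (b - t • u)
    rw [norm_neg] at h4
    linarith
  have dab : ‖a - b‖ ≤ 4 * r := by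
    have : a - b = (a - t • u) - (b - t • u) := by abel
    rw [this]
    linarith [norm_sub_le (a - t • u) (b - t • u)]
  refine ⟨m₁, h₁, m₂, h₂, m₃, h₃, by linarith, by linarith, by linarith, by linarith, ?_, ?_⟩
  · rw [hab]; linarith
  · rw [hab]
    by_contra! hcon
    -- It yields `(‖a‖ + ‖b‖)² - ‖a + b‖² ≤ ‖a - b‖²`, which is bounded in `t`, whereas `‖a‖ + ‖b‖ +
    -- ‖a + b‖` grows with `t`.
    have hpar := parallelogram_law_with_norm ℝ a b
    have hsq : ‖a - b‖ ^ 2 ≤ 16 * r ^ 2 := by nlinarith [norm_nonneg (a - b)]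
    have h5 : (‖a‖ + ‖b‖ - ‖a + b‖) * (‖a‖ + ‖b‖ + ‖a + b‖) ≤ 16 * r ^ 2 := by
      nlinarith [sq_nonneg (‖a‖ - ‖b‖)]
    have h6 : 16 * r ^ 2 / ε + 1 ≤ ‖a‖ + ‖b‖ + ‖a + b‖ := by linarith
    have h7 : ε * (16 * r ^ 2 / ε + 1) ≤
        (‖a‖ + ‖b‖ - ‖a + b‖) * (‖a‖ + ‖b‖ + ‖a + b‖) := by
      gcongr
      linarith
    have h8 : ε * (16 * r ^ 2 / ε + 1) = 16 * r ^ 2 + ε := by field_simp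
    linarith

/-! ### Ellipsoids and the conclusion. -/

theorem IsExpOrthogonalBasis.setIntegral_expChar_sub {d : ℕ}
    {D Λ : Set (EuclideanSpace ℝ (Fin d))} (h : IsExpOrthogonalBasis D Λ)
    {ξ η : EuclideanSpace ℝ (Fin d)} (hξ : ξ ∈ Λ) (hη : η ∈ Λ) (hne : ξ ≠ η) :
    ∫ x in D, expChar (η - ξ) x = 0 := by
  obtain ⟨e, he, ho, -⟩ := h
  have h1 := ho (show (⟨ξ, hξ⟩ : Λ) ≠ ⟨η, hη⟩ from fun h => hne (congrArg Subtype.val h))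
  simp only [L2.inner_def] at h1
  rw [← h1]
  refine integral_congr_ae ?_
  filter_upwards [he ⟨ξ, hξ⟩, he ⟨η, hη⟩] with x h1 h2
  rw [h1, h2, ← conj_expChar_mul, RCLike.inner_apply, mul_comm]

theorem AffineMap.eq_linear_add {d : ℕ}
    (T : EuclideanSpace ℝ (Fin d) →ᵃ[ℝ] EuclideanSpace ℝ (Fin d)) (x : EuclideanSpace ℝ (Fin d)) :
    T x = T.linear x + T 0 :=
  congrFun T.decomp x

theorem AffineMap.det_ne_zero_of_volume_image {d : ℕ}
    {T : EuclideanSpace ℝ (Fin d) →ᵃ[ℝ] EuclideanSpace ℝ (Fin d)}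
    {s : Set (EuclideanSpace ℝ (Fin d))} (h : volume (T '' s) ≠ 0) :
    LinearMap.det T.linear ≠ 0 := by
  intro h0
  apply h
  have : T '' s = (fun x => x + T 0) '' (T.linear '' s) := by
    rw [Set.image_image]
    exact Set.image_congr fun x _ => T.eq_linear_add x
  rw [this, Set.image_add_right, measure_preimage_add_right, Measure.addHaar_image_linearMap, h0]
  simp

/-- The vanishing of the Fourier transform of an ellipsoid in terms of the profile of the ball. -/
theorem ballProfile_eq_zero_of_setIntegral_affine_image {n : ℕ}
    {T : EuclideanSpace ℝ (Fin (n + 1)) →ᵃ[ℝ] EuclideanSpace ℝ (Fin (n + 1))}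
    (hT : LinearMap.det T.linear ≠ 0) {η : EuclideanSpace ℝ (Fin (n + 1))}
    (h : ∫ x in T '' Metric.closedBall 0 1, expChar η x = 0) :
    ballProfile n ‖(2 * Real.pi) • LinearMap.adjoint T.linear η‖ = 0 := by
  set A := T.linear with hA
  have hTA : ∀ x, T x = A x + T 0 := T.eq_linear_add
  have hAinj : Function.Injective A :=
    ((Module.End.isUnit_iff A).1 ((LinearMap.isUnit_iff_isUnit_det A).2 hT.isUnit)).1
  have hinj : Function.Injective T := fun x y hxy => hAinj (by
    rw [hTA x, hTA y] at hxy; exact add_right_cancel hxy)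
  have hderiv : ∀ x ∈ Metric.closedBall (0 : EuclideanSpace ℝ (Fin (n + 1))) 1,
      HasFDerivWithinAt T A.toContinuousLinearMap (Metric.closedBall 0 1) x := fun x _ => by
    have := (A.toContinuousLinearMap.hasFDerivAt (x := x)).add_const (T 0)
    exact (this.congr_of_eventuallyEq
      (Filter.Eventually.of_forall hTA)).hasFDerivWithinAt
  rw [integral_image_eq_integral_abs_det_fderiv_smul volume
    Metric.isClosed_closedBall.measurableSet hderiv hinj.injOn, integral_smul] at h
  have hdet : |A.toContinuousLinearMap.det| ≠ 0 := abs_ne_zero.2 hT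
  have h1 := (smul_eq_zero.1 h).resolve_left hdet
  set y := (2 * Real.pi) • LinearMap.adjoint A η with hy
  have h2 : ∀ x, expChar η (T x) = Complex.exp ((inner ℝ x y : ℝ) * Complex.I) * expChar η (T 0) := by
    intro x
    rw [expChar, expChar, ← Complex.exp_add, hTA x, hy, inner_add_left, inner_smul_right,
      LinearMap.adjoint_inner_right]
    congr 1
    push_cast
    ring
  rw [integral_congr_ae (Filter.Eventually.of_forall h2), integral_mul_const] at h1
  have h3 : expChar η (T 0) ≠ 0 := by
    rw [← norm_ne_zero_iff, norm_expChar]; exact one_ne_zero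
  have h4 := (mul_eq_zero.1 h1).resolve_right h3
  have hint : IntegrableOn (fun x => Complex.exp ((inner ℝ x y : ℝ) * Complex.I))
      (Metric.closedBall (0 : EuclideanSpace ℝ (Fin (n + 1))) 1) :=
    (by fun_prop : Continuous fun x : EuclideanSpace ℝ (Fin (n + 1)) =>
      Complex.exp ((inner ℝ x y : ℝ) * Complex.I)).continuousOn.integrableOn_compact
      (isCompact_closedBall _ _)
  -- The real part suffices, since only the vanishing of the cosine integral is needed.
  have h5 := integral_re hint
  rw [h4] at h5
  simp only [RCLike.re_to_complex, Complex.exp_ofReal_mul_I_re, Complex.zero_re] at h5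
  rw [setIntegral_closedBall_cos_inner] at h5
  refine (mul_eq_zero.1 h5).resolve_left (ENNReal.toReal_pos ?_ ?_).ne'
  · exact (Metric.measure_closedBall_pos volume _ one_pos).ne'
  · exact measure_closedBall_lt_top.ne

theorem theorem1 (d : ℕ) (hd : 2 ≤ d)
    (T : EuclideanSpace ℝ (Fin d) →ᵃ[ℝ] EuclideanSpace ℝ (Fin d)) :
    ¬ IsSpectralSet (T '' Metric.closedBall (0 : EuclideanSpace ℝ (Fin d)) 1) := by
  rintro ⟨⟨-, hvol, -⟩, Λ, -, hΛ⟩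
  obtain ⟨n, rfl⟩ : ∃ n, d = n + 1 := ⟨d - 1, by omega⟩
  have hdet := AffineMap.det_ne_zero_of_volume_image hvol
  set A := T.linear with hA
  have hunit : IsUnit A := (LinearMap.isUnit_iff_isUnit_det A).2 hdet.isUnit
  have hsurj : Function.Surjective A := (Module.End.isUnit_iff A).1 hunit |>.2
  have hadj : Function.Surjective (LinearMap.adjoint A) := by
    have : IsUnit (LinearMap.adjoint A) := by
      rw [← LinearMap.star_eq_adjoint]; exact hunit.star
    exact ((Module.End.isUnit_iff _).1 this).2
  have hopen : IsOpenMap T := by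
    have h1 := (Homeomorph.addRight (T 0)).isOpenMap.comp
      (A.isOpenMap_of_finiteDimensional hsurj)
    convert h1 using 1
    ext1 x
    exact T.eq_linear_add x
  have hint : (interior (T '' Metric.closedBall 0 1)).Nonempty :=
    ⟨T 0, interior_maximal (Set.image_mono Metric.ball_subset_closedBall)
      (hopen _ Metric.isOpen_ball) ⟨0, Metric.mem_ball_self one_pos, rfl⟩⟩
  obtain ⟨r, hr⟩ := hΛ.relatively_dense hint
  -- This map turns the ellipsoid's zero set into that of the ball. Being bounded and surjective, it
  -- preserves relative density.
  set C : EuclideanSpace ℝ (Fin (n + 1)) →L[ℝ] EuclideanSpace ℝ (Fin (n + 1)) :=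
    ((2 * Real.pi) • LinearMap.adjoint A).toContinuousLinearMap with hC
  have hCapp : ∀ x, C x = (2 * Real.pi) • LinearMap.adjoint A x := fun _ => rfl
  have hCsurj : Function.Surjective C := by
    intro ζ
    obtain ⟨ξ, hξ⟩ := hadj ((2 * Real.pi)⁻¹ • ζ)
    exact ⟨ξ, by rw [hCapp, hξ, smul_inv_smul₀ (by positivity)]⟩
  have hM : ∀ ζ, ∃ m ∈ C '' Λ, ‖m - ζ‖ ≤ ‖C‖ * r := by
    intro ζ
    obtain ⟨ξ, rfl⟩ := hCsurj ζ
    obtain ⟨lam, hlam, hle⟩ := hr ξ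
    refine ⟨C lam, ⟨lam, hlam, rfl⟩, ?_⟩
    rw [← map_sub]
    exact (C.le_opNorm _).trans (by gcongr)
  have hzero : ∀ m ∈ C '' Λ, ∀ m' ∈ C '' Λ, 0 < ‖m' - m‖ → ballProfile n ‖m' - m‖ = 0 := by
    rintro _ ⟨ξ, hξ, rfl⟩ _ ⟨η, hη, rfl⟩ hpos
    have hne : ξ ≠ η := by
      rintro rfl
      simp at hpos
    rw [← map_sub, hCapp]
    exact ballProfile_eq_zero_of_setIntegral_affine_image hdet
      (hΛ.setIntegral_expChar_sub hξ hη hne)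
  obtain ⟨R, ε, hε, hgap⟩ := exists_ballProfile_excess_gap n (by omega)
  obtain ⟨m₁, h₁, m₂, h₂, m₃, h₃, p₁, p₂, l₁, l₂, l₃, hlt⟩ := exists_almost_collinear hM
    (u := EuclideanSpace.single 0 1) (by simp) R hε
  have htri : ‖m₃ - m₁‖ ≤ ‖m₂ - m₁‖ + ‖m₃ - m₂‖ :=
    (norm_sub_le_norm_sub_add_norm_sub m₃ m₂ m₁).trans_eq (add_comm _ _)
  exact absurd (hgap _ _ _ l₁ l₂ l₃ (hzero _ h₁ _ h₂ p₁) (hzero _ h₂ _ h₃ p₂)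
    (hzero _ h₁ _ h₃ (p₁.trans_le l₃)) htri) (not_le.2 hlt)
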